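/- Conventions. A uniform (or function) algebra on a compact Hausdorff space $\Omega$ is a uniformly closed subalgebra $A\subseteq C(\Omega)$ (complex-valued continuous functions) that contains the constants and separates the points of $\Omega$; $A^{-1}$ denotes the elements invertible in $A$. Points $w\in\Omega$ are regarded as (evaluation) characters of $A$; two characters $\varphi,\psi$ of $A$ lie in the same Gleason part of $A$ iff $\|\varphi-\psi\|_{A^*}<2$. For a unital subalgebra $B\subseteq C(\Omega)$: - $\bar Q^{+}_{B}$ is the set of strictly positive functions in the uniform closure of $\{|b| : b\in B^{-1}\}$. - $\mathcal M_{B}$ is the set of strictly positive $f\in C(\Omega)$ for which there are $m_n\in\mathbb N$ and $m_n$-tuples $K_n=(k_{n,i})_i$, $H_n=(h_{n,i})_i$ over $B$ with $\sum_i k_{n,i}h_{n,i}=1$ for all $n$, $\|K_n(w)\|_2\to f(w)$ and $\|H_n(w)\|_2\to f(w)^{-1}$, both uniformly on $\Omega$. - For strictly positive $f\in C(\Omega)$, $Bf$ is a strong Morita equivalence bimodule (with inverse bimodule $Bf^{-1}$) if for every $\varepsilon>0$ there are finitely many $x_i\in Bf$, $y_i\in Bf^{-1}$ with $\sum_i x_iy_i=1$,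 $\sum_i|x_i|^2\le 1+\varepsilon$ and $\sum_i|y_i|^2\le1+\varepsilon$ on $\Omega$. It is a strong subequivalence bimodule if for every $\varepsilon>0$ there are finitely many $x_i\in Bf$, $y_i\in Bf^{-1}$ with $1-\varepsilon\le\sum_i|x_i|^2\le1+\varepsilon$ and $1-\varepsilon\le\sum_i|y_i|^2\le1+\varepsilon$ on $\Omega$; it is a unitary subequivalence bimodule if there are $x\in Bf$, $y\in Bf^{-1}$ with $|x|=|y|=1$ on $\Omega$. Theorem. (1) Let $A$ be a uniform algebra on a compact Hausdorff space $\Omega$, let $w_1\ne w_2$ be points of $\Omega$, and let $G\in A^{-1}$ satisfy $G(w_1)=1=-G(w_2)$. Put $A_0=\{a\in A: a(w_1)=a(w_2)\}$ and $f=|G|$. Then $f\in\mathcal M_{A_0}$ if and only if $w_1$ and $w_2$ lie in different Gleason parts of $A$, and this holds if and only if $f\in\bar Q^{+}_{A_0}$. (2) Let $A(\mathbb D)$ be the disk algebra (continuous functions on $\overline{\mathbb D}$, holomorphic on $\mathbb D$), let $\alpha\ne\beta$ be points of the open disk $\mathbb D$, and let $A_0\subseteq C(\mathbb T)$ be the algebra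 of restrictions to the unit circle $\mathbb T$ of $\{a\in A(\mathbb D): a(\alpha)=a(\beta)\}$. Then $A_0$ is a uniform algebra on $\mathbb T$, there is $G\in A(\mathbb D)^{-1}$ with $G(\alpha)=-G(\beta)$, and for every such $G$ the submodule $A_0|G|$ of $C(\mathbb T)$ is a unitary subequivalence bimodule and a strong subequivalence bimodule, but not a strong Morita equivalence bimodule. In particular, strong subequivalence differs from strong Morita equivalence. -/

import Mathlib

open Filter Topology

noncomputable section

namespace FunctionAlgebra

section Definitions

variable {Ω : Type*} [TopologicalSpace Ω] [CompactSpace Ω]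

/-- A uniform (function) algebra on `Ω`: a uniformly closed point-separating subalgebra of
`C(Ω, ℂ)`. It contains the constants because it is a `Subalgebra`. -/
structure IsUniformAlgebra (A : Subalgebra ℂ C(Ω, ℂ)) : Prop where
  isClosed : IsClosed (A : Set C(Ω, ℂ))
  separatesPoints : A.SeparatesPoints

/-- The modulus `|g|` as a real continuous function. -/
def modulus (g : C(Ω, ℂ)) : C(Ω, ℝ) where
  toFun w := ‖g w‖
  continuous_toFun := g.continuous.norm

/-- `Q`: moduli of invertible elements of `A` (the inverse is taken in `A`). -/
def invModuli (A : Subalgebra ℂ C(Ω, ℂ)) : Set C(Ω, ℝ) :=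
  {f | ∃ g : A, IsUnit g ∧ f = modulus (g : C(Ω, ℂ))}

/-- `Q̄⁺`: the strictly positive functions in the uniform closure of `Q`. -/
def invModuliClosurePos (A : Subalgebra ℂ C(Ω, ℂ)) : Set C(Ω, ℝ) :=
  {f | f ∈ closure (invModuli A) ∧ ∀ w, 0 < f w}

/-- The Euclidean length `‖K(w)‖₂` of a tuple of functions at the point `w`. -/
def tupleNorm {A : Subalgebra ℂ C(Ω, ℂ)} {m : ℕ} (K : Fin m → A) (w : Ω) : ℝ :=
  Real.sqrt (∑ i, ‖(K i : C(Ω, ℂ)) w‖ ^ 2)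

/-- The class `𝓜_A`: strictly positive `f` for which there are tuples `Kₙ, Hₙ` over `A` (of the
same length `mₙ`) with `Kₙ . Hₙ = 1`, `‖Kₙ(w)‖₂ → f(w)` and `‖Hₙ(w)‖₂ → f(w)⁻¹`, uniformly. -/
def tightClass (A : Subalgebra ℂ C(Ω, ℂ)) : Set C(Ω, ℝ) :=
  {f | (∀ w, 0 < f w) ∧
    ∃ (m : ℕ → ℕ) (K H : (n : ℕ) → Fin (m n) → A),
      (∀ n, ∑ i, K n i * H n i = 1) ∧
      TendstoUniformly (fun n w => tupleNorm (K n) w) (fun w => f w) atTop ∧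
      TendstoUniformly (fun n w => tupleNorm (H n) w) (fun w => (f w)⁻¹) atTop}

/-- Evaluation at a point of `Ω`, as a point of the maximal ideal space of `A`. -/
def evalCharacter (A : Subalgebra ℂ C(Ω, ℂ)) (w : Ω) : WeakDual.characterSpace ℂ A :=
  ⟨StrongDual.toWeakDual
      ((ContinuousMap.evalCLM ℂ w).comp (Subalgebra.toSubmodule A).subtypeL), by
    refine ⟨fun h => ?_, fun a b => rfl⟩
    have h1 := congrArg (fun φ : WeakDual ℂ A => φ 1) h
    exact one_ne_zero (α := ℂ) h1⟩

/-- Two points of the maximal ideal space are equivalent when their distance in the norm of the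
dual space of `A` is less than `2`. -/
def GleasonEquivalent {A : Subalgebra ℂ C(Ω, ℂ)} (φ ψ : WeakDual.characterSpace ℂ A) : Prop :=
  ‖WeakDual.toStrongDual (φ : WeakDual ℂ A) - WeakDual.toStrongDual (ψ : WeakDual ℂ A)‖ < 2

/-- The Gleason part of `φ`: its class for the relation above. -/
def gleasonPart {A : Subalgebra ℂ C(Ω, ℂ)} (φ : WeakDual.characterSpace ℂ A) :
    Set (WeakDual.characterSpace ℂ A) :=
  {ψ | GleasonEquivalent φ ψ}

/-- `{a ∈ A : a(w₁) = a(w₂)}`. -/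
def twoPointSubalgebra (A : Subalgebra ℂ C(Ω, ℂ)) (w₁ w₂ : Ω) : Subalgebra ℂ C(Ω, ℂ) where
  carrier := {a | a ∈ A ∧ a w₁ = a w₂}
  mul_mem' := fun ha hb => ⟨A.mul_mem ha.1 hb.1, by simp [ha.2, hb.2]⟩
  add_mem' := fun ha hb => ⟨A.add_mem ha.1 hb.1, by simp [ha.2, hb.2]⟩
  algebraMap_mem' := fun r => ⟨A.algebraMap_mem r, by simp⟩

/-- The module `A f = {a f : a ∈ A}` inside `C(Ω, ℂ)`, for a real function `f`. -/
def cyclicModule (A : Subalgebra ℂ C(Ω, ℂ)) (f : Ω → ℝ) : Set C(Ω, ℂ) :=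
  {x | ∃ a ∈ A, ∀ w, x w = a w * (f w : ℂ)}

/-- For strictly positive `f`: `A f` is a strong Morita equivalence bimodule, with inverse
bimodule `A f⁻¹`. -/
def IsStrongMoritaBimodule (A : Subalgebra ℂ C(Ω, ℂ)) (f : C(Ω, ℝ)) : Prop :=
  ∀ ε : ℝ, 0 < ε → ∃ (n : ℕ) (x y : Fin n → C(Ω, ℂ)),
    (∀ i, x i ∈ cyclicModule A (fun w => f w)) ∧
    (∀ i, y i ∈ cyclicModule A (fun w => (f w)⁻¹)) ∧
    ∑ i, x i * y i = 1 ∧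
    ∀ w, ∑ i, ‖x i w‖ ^ 2 ≤ 1 + ε ∧ ∑ i, ‖y i w‖ ^ 2 ≤ 1 + ε

/-- For strictly positive `f`: `A f` is a strong subequivalence bimodule. The two families may be
taken of the same length, since either can be padded with zeros. -/
def IsStrongSubequivalenceBimodule (A : Subalgebra ℂ C(Ω, ℂ)) (f : C(Ω, ℝ)) : Prop :=
  ∀ ε : ℝ, 0 < ε → ∃ (n : ℕ) (x y : Fin n → C(Ω, ℂ)),
    (∀ i, x i ∈ cyclicModule A (fun w => f w)) ∧
    (∀ i, y i ∈ cyclicModule A (fun w => (f w)⁻¹)) ∧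
    ∀ w, (1 - ε ≤ ∑ i, ‖x i w‖ ^ 2 ∧ ∑ i, ‖x i w‖ ^ 2 ≤ 1 + ε) ∧
      (1 - ε ≤ ∑ i, ‖y i w‖ ^ 2 ∧ ∑ i, ‖y i w‖ ^ 2 ≤ 1 + ε)

/-- For strictly positive `f`: `A f` is a unitary subequivalence bimodule, that is, `A f` and
`A f⁻¹` contain functions of constant modulus one. -/
def IsUnitarySubequivalenceBimodule (A : Subalgebra ℂ C(Ω, ℂ)) (f : C(Ω, ℝ)) : Prop :=
  ∃ x ∈ cyclicModule A (fun w => f w), ∃ y ∈ cyclicModule A (fun w => (f w)⁻¹),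
    ∀ w, ‖x w‖ = 1 ∧ ‖y w‖ = 1

end Definitions

section Disk

/-- The closed unit disk of `ℂ`. -/
abbrev ClosedDisk : Type := Metric.closedBall (0 : ℂ) 1

/-- The unit circle of `ℂ`. -/
abbrev UnitCircle : Type := Metric.sphere (0 : ℂ) 1

instance : CompactSpace ClosedDisk :=
  isCompact_iff_compactSpace.mp (isCompact_closedBall (0 : ℂ) 1)

instance : CompactSpace UnitCircle :=
  isCompact_iff_compactSpace.mp (isCompact_sphere (0 : ℂ) 1)

/-- The disk algebra: continuous functions on the closed disk, holomorphic on the open disk. -/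
def diskAlgebra : Subalgebra ℂ C(ClosedDisk, ℂ) where
  carrier := {f | ∃ F : ℂ → ℂ, DifferentiableOn ℂ F (Metric.ball 0 1) ∧
    ∀ z : ClosedDisk, (z : ℂ) ∈ Metric.ball (0 : ℂ) 1 → F z = f z}
  mul_mem' := by
    rintro f g ⟨F, hF, hf⟩ ⟨G, hG, hg⟩
    exact ⟨F * G, hF.mul hG, fun z hz => by simp [hf z hz, hg z hz]⟩
  add_mem' := by
    rintro f g ⟨F, hF, hf⟩ ⟨G, hG, hg⟩
    exact ⟨F + G, hF.add hG, fun z hz => by simp [hf z hz, hg z hz]⟩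
  algebraMap_mem' := fun r => ⟨fun _ => r, differentiableOn_const r, fun _ _ => rfl⟩

/-- The inclusion of the circle in the closed disk. -/
def circleInclusion : C(UnitCircle, ClosedDisk) where
  toFun z := ⟨z, Metric.sphere_subset_closedBall z.2⟩
  continuous_toFun := continuous_subtype_val.subtype_mk _

/-- The algebra of restrictions to the circle of the functions in `B`. -/
def restrictToCircle (B : Subalgebra ℂ C(ClosedDisk, ℂ)) : Subalgebra ℂ C(UnitCircle, ℂ) :=
  B.map (ContinuousMap.compRightAlgHom ℂ ℂ circleInclusion)

end Disk

end FunctionAlgebra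

end

open FunctionAlgebra

/-! Both halves turn on functions of norm nearly one with the values 1 and -1 at the two points.

Uniform algebras. If the points lie in different Gleason parts, a rotated element `a` of the unit
ball has `a w₁` near 1 and `a w₂` near -1. The conformal map log((1+z)/(1-z)) of the disk onto a
strip turns `a` into `h ∈ A` with bounded imaginary part and huge `h w₁ - h w₂`. Rescaling this
difference to π gives `k` with tiny imaginary part, and `u = exp(ik)` is a unit of modulus near one
with `u w₁ = -u w₂`. Then `G * u` is a unit of `A₀` whose modulus is near `|G|`. Conversely, if
tuples `K`, `H` over `A₀` witness `|G| ∈ 𝓜`, then `∑ Hᵢ(w₁) Kᵢ G⁻¹` takes the values 1 and -1, and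
Cauchy-Schwarz bounds its norm by nearly one, so the characters are at distance at least 2. The
inclusion `Q̄⁺ ⊆ 𝓜` closes the cycle.

Disk algebra. A Blaschke product `b` with `b α = -b β` puts `b G` and `b G⁻¹` in `A₀`, and `|b| = 1`
on the circle; this gives the unitary elements. Subequivalence does not ask that the two families
pair to 1. The Morita condition does, and the converse construction above, carried into the disk by
the maximum principle, then gives functions of norm at most 1 + ε with values 1 and -1 at `α` and
`β`. The Schwarz lemma forbids this for small ε. -/

open Filter Topology

namespace FunctionAlgebra

open scoped ComplexConjugate

/-- The Cauchy-Schwarz inequality for finite sums of complex numbers. -/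
theorem norm_sum_mul_le_sqrt_mul_sqrt {ι : Type*} (s : Finset ι) (z w : ι → ℂ) :
    ‖∑ i ∈ s, z i * w i‖ ≤ √(∑ i ∈ s, ‖z i‖ ^ 2) * √(∑ i ∈ s, ‖w i‖ ^ 2) :=
  ((norm_sum_le _ _).trans (by simp only [norm_mul, le_refl])).trans
    (Real.sum_mul_le_sqrt_mul_sqrt s (fun i => ‖z i‖) fun i => ‖w i‖)

/-! ### Gleason parts and moduli of units in a uniform algebra. -/

section UniformAlgebra

variable {Ω : Type*} [TopologicalSpace Ω] {A : Subalgebra ℂ C(Ω, ℂ)}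

theorem mul_eq_one_apply {g k : A} (h : g * k = 1) (w : Ω) :
    (g : C(Ω, ℂ)) w * (k : C(Ω, ℂ)) w = 1 := by
  have := congrArg (fun a : A => (a : C(Ω, ℂ)) w) h
  simpa using this

theorem sum_mul_eq_one_apply {m : ℕ} {K H : Fin m → A} (h : ∑ i, K i * H i = 1) (w : Ω) :
    ∑ i, (K i : C(Ω, ℂ)) w * (H i : C(Ω, ℂ)) w = 1 := by
  have := congrArg (fun a : A => (a : C(Ω, ℂ)) w) h
  simpa [ContinuousMap.sum_apply] using this

variable [CompactSpace Ω]

/-- Units and their inverses serve as tuples of length one; inversion preserves the uniform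
convergence because `f` is bounded below on the compact space. -/
theorem invModuliClosurePos_subset_tightClass (A : Subalgebra ℂ C(Ω, ℂ)) :
    invModuliClosurePos A ⊆ tightClass A := by
  rintro f ⟨hf, hpos⟩
  obtain ⟨F, hF, hlim⟩ := mem_closure_iff_seq_limit.1 hf
  choose g hg hFg using hF
  choose k hk using fun n => (hg n).exists_right_inv
  have hunif := ContinuousMap.tendsto_iff_tendstoUniformly.1 hlim
  have hinv : TendstoUniformly (fun n w => (F n w)⁻¹) (fun w => (f w)⁻¹) atTop := by
    rw [← tendstoLocallyUniformly_iff_tendstoUniformly_of_compactSpace] at hunif ⊢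
    exact hunif.fun_inv₀ f.continuous fun w => (hpos w).ne'
  refine ⟨hpos, fun _ => 1, fun n _ => g n, fun n _ => k n, fun n => by simp [hk n], ?_, ?_⟩
  · convert hunif using 3 with n w
    simp [tupleNorm, hFg n, modulus]
  · convert hinv using 3 with n w
    have h1 := congrArg norm (mul_eq_one_apply (hk n) w)
    rw [norm_mul, norm_one] at h1
    simpa [tupleNorm, hFg n, modulus] using eq_inv_of_mul_eq_one_right h1

theorem exists_mem_exp (hA : IsClosed (A : Set C(Ω, ℂ))) {h : C(Ω, ℂ)} (hh : h ∈ A) :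
    ∃ u ∈ A, ∀ w, u w = Complex.exp (h w) := by
  refine ⟨NormedSpace.exp h, NormedSpace.exp_mem (R := ℂ) hA hh, fun w => ?_⟩
  rw [Complex.exp_eq_exp_ℂ]
  exact NormedSpace.map_exp (ContinuousMap.evalAlgHom ℂ ℂ w)
    (ContinuousMap.evalCLM ℂ w).continuous h

theorem exists_mem_neg_log_one_sub (hA : IsClosed (A : Set C(Ω, ℂ))) {a : C(Ω, ℂ)} (ha : a ∈ A)
    (hn : ‖a‖ < 1) : ∃ l ∈ A, ∀ w, l w = -Complex.log (1 - a w) := by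
  have hsum : Summable fun n : ℕ => ((n : ℂ)⁻¹) • a ^ n := by
    refine Summable.of_norm_bounded (summable_geometric_of_lt_one (norm_nonneg a) hn) fun n => ?_
    rcases n.eq_zero_or_pos with rfl | hpos
    -- The term `n = 0` vanishes since `(0 : ℂ)⁻¹ = 0`, as in the Taylor series of the logarithm.
    · simp
    · refine (norm_smul_le _ _).trans ?_
      rw [norm_inv, Complex.norm_natCast]
      have h1 : (n : ℝ)⁻¹ ≤ 1 := inv_le_one_of_one_le₀ (by exact_mod_cast hpos)
      calc _ ≤ 1 * ‖a‖ ^ n := by gcongr; exact norm_pow_le' a hpos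
        _ = _ := one_mul _
  refine ⟨∑' n : ℕ, ((n : ℂ)⁻¹) • a ^ n, ?_, fun w => ?_⟩
  · exact hA.mem_of_tendsto hsum.hasSum (Eventually.of_forall fun s =>
      A.sum_mem fun n _ => A.smul_mem (A.pow_mem ha n) _)
  · have h1 := hsum.hasSum.mapL (ContinuousMap.evalCLM ℂ w)
    have h2 := Complex.hasSum_taylorSeries_neg_log ((a.norm_coe_le_norm w).trans_lt hn)
    refine HasSum.unique (f := fun n : ℕ => (a w) ^ n / n) ?_ h2
    change HasSum _ (ContinuousMap.evalCLM ℂ w _)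
    convert h1 using 2 with n
    simp [div_eq_inv_mul]

@[simp]
theorem evalCharacter_sub_apply (w₁ w₂ : Ω) (a : A) :
    (WeakDual.toStrongDual (evalCharacter A w₁ : WeakDual ℂ A) -
      WeakDual.toStrongDual (evalCharacter A w₂ : WeakDual ℂ A)) a =
      (a : C(Ω, ℂ)) w₁ - (a : C(Ω, ℂ)) w₂ := rfl

/-- Points in different Gleason parts are separated by elements of the unit ball whose values
differ by a real number close to `2`. -/
theorem exists_sub_eq_ofReal_of_notMem_gleasonPart {w₁ w₂ : Ω}
    (h : evalCharacter A w₂ ∉ gleasonPart (evalCharacter A w₁)) {r : ℝ} (hr0 : 0 ≤ r) (hr : r < 2) :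
    ∃ a ∈ A, ‖a‖ < 1 ∧ ∃ s : ℝ, r < s ∧ a w₁ - a w₂ = s := by
  have h2 : r < ‖WeakDual.toStrongDual (evalCharacter A w₁ : WeakDual ℂ A) -
      WeakDual.toStrongDual (evalCharacter A w₂ : WeakDual ℂ A)‖ :=
    hr.trans_le (not_lt.1 h)
  obtain ⟨a, ha, hra⟩ := ContinuousLinearMap.exists_lt_apply_of_lt_opNorm _ h2
  rw [evalCharacter_sub_apply] at hra
  set d := (a : C(Ω, ℂ)) w₁ - (a : C(Ω, ℂ)) w₂ with hd
  have hd0 : (‖d‖ : ℂ) ≠ 0 := by exact_mod_cast (hr0.trans_lt hra).ne'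
  -- Rotation by this unimodular constant makes the difference real and positive.
  have hc : ‖conj d / ‖d‖‖ = 1 := by
    rw [norm_div, Complex.norm_conj, Complex.norm_real, norm_norm,
      div_self (hr0.trans_lt hra).ne']
  refine ⟨(conj d / ‖d‖) • (a : C(Ω, ℂ)), A.smul_mem a.2 _, ?_, ‖d‖, hra, ?_⟩
  · rw [norm_smul, hc, one_mul]
    exact ha
  · simp only [ContinuousMap.smul_apply, smul_eq_mul]
    rw [← mul_sub, ← hd, div_mul_eq_mul_div, Complex.conj_mul', sq, mul_div_assoc,
      div_self hd0, mul_one]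

/-- In the unit disk `|1 - z|² < 2(1 - Re z)`, so the hypothesis gives `|1 - z| ≤ exp(-M)`, while
`|1 + z| ≥ 1`. -/
theorem le_re_log_sub_log {M : ℝ} {z : ℂ} (hM : 0 ≤ M) (hz : ‖z‖ < 1)
    (hre : 1 - Real.exp (-(2 * M)) / 2 < z.re) :
    M ≤ (Complex.log (1 + z) - Complex.log (1 - z)).re := by
  have he : Real.exp (-(2 * M)) ≤ 1 := Real.exp_le_one_iff.2 (by linarith)
  have h1 : 0 ≤ Real.log ‖1 + z‖ := by
    refine Real.log_nonneg ?_
    have := Complex.re_le_norm (1 + z)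
    simp only [Complex.add_re, Complex.one_re] at this
    linarith
  have hz1 : 0 < ‖1 - z‖ := by
    refine norm_pos_iff.2 fun h => ?_
    rw [← sub_eq_zero.1 h] at hz
    simp at hz
  have h2 : Real.log ‖1 - z‖ ≤ -M := by
    have hsq : ‖1 - z‖ ^ 2 ≤ Real.exp (-M) ^ 2 := by
      rw [← Real.exp_nat_mul]
      have h3 : ‖z‖ ^ 2 < 1 := by nlinarith [norm_nonneg z]
      rw [← Complex.normSq_eq_norm_sq, Complex.normSq_apply] at h3 ⊢
      simp only [Complex.sub_re, Complex.one_re, Complex.sub_im, Complex.one_im]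
      push_cast
      rw [mul_neg]
      nlinarith
    rw [Real.log_le_iff_le_exp hz1]
    exact (pow_le_pow_iff_left₀ hz1.le (Real.exp_pos _).le two_ne_zero).1 hsq
  rw [Complex.sub_re, Complex.log_re, Complex.log_re]
  linarith

theorem abs_im_log_sub_log_le (z w : ℂ) :
    |(Complex.log z - Complex.log w).im| ≤ 2 * Real.pi := by
  rw [Complex.sub_im, Complex.log_im, Complex.log_im]
  refine (abs_sub _ _).trans ?_
  linarith [Complex.abs_arg_le_pi z, Complex.abs_arg_le_pi w]

/-- Points in different Gleason parts are arbitrarily far apart for elements with values in a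
fixed horizontal strip. -/
theorem exists_re_sub_ge_of_notMem_gleasonPart (hA : IsClosed (A : Set C(Ω, ℂ))) {w₁ w₂ : Ω}
    (h : evalCharacter A w₂ ∉ gleasonPart (evalCharacter A w₁)) {M : ℝ} (hM : 0 ≤ M) :
    ∃ h ∈ A, (∀ w, |(h w).im| ≤ 2 * Real.pi) ∧ 2 * M ≤ (h w₁ - h w₂).re := by
  have he := Real.exp_pos (-(2 * M))
  have he1 : Real.exp (-(2 * M)) ≤ 1 := Real.exp_le_one_iff.2 (by linarith)
  -- Both real parts lie in `[-1, 1]`, so a difference above 2 - η forces `Re a(w₁) > 1 - η` and `Re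
  -- (-a(w₂)) > 1 - η`; here η is the threshold of `le_re_log_sub_log`.
  obtain ⟨a, ha, hn, s, hs, has⟩ := exists_sub_eq_ofReal_of_notMem_gleasonPart h
    (r := 2 - Real.exp (-(2 * M)) / 2) (by linarith) (by linarith)
  have hnw : ∀ w, ‖a w‖ < 1 := fun w => (a.norm_coe_le_norm w).trans_lt hn
  have hre : (a w₁).re - (a w₂).re = s := by
    simpa using congrArg Complex.re has
  have b1 := abs_le.1 ((Complex.abs_re_le_norm (a w₁)).trans (hnw w₁).le)
  have b2 := abs_le.1 ((Complex.abs_re_le_norm (a w₂)).trans (hnw w₂).le)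
  obtain ⟨l, hl, hlw⟩ := exists_mem_neg_log_one_sub hA ha hn
  obtain ⟨k, hk, hkw⟩ := exists_mem_neg_log_one_sub hA (A.neg_mem ha) (by rwa [norm_neg])
  have hval : ∀ w, (l - k) w = Complex.log (1 + a w) - Complex.log (1 - a w) := fun w => by
    simp only [ContinuousMap.sub_apply, hlw, hkw, ContinuousMap.neg_apply]
    ring_nf
  refine ⟨l - k, A.sub_mem hl hk, fun w => ?_, ?_⟩
  · rw [hval]
    exact abs_im_log_sub_log_le _ _
  · have e1 := le_re_log_sub_log hM (hnw w₁) (by linarith)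
    have e2 := le_re_log_sub_log (z := -a w₂) hM (by rw [norm_neg]; exact hnw w₂)
      (by rw [Complex.neg_re]; linarith)
    rw [sub_neg_eq_add, ← sub_eq_add_neg] at e2
    rw [hval, hval]
    simp only [Complex.sub_re] at e1 e2 ⊢
    linarith

/-- Points in different Gleason parts are given opposite values by invertible elements of modulus
close to one. -/
theorem exists_unit_apply_eq_neg_of_notMem_gleasonPart (hA : IsUniformAlgebra A) {w₁ w₂ : Ω}
    (hw : w₁ ≠ w₂) (h : evalCharacter A w₂ ∉ gleasonPart (evalCharacter A w₁)) {δ : ℝ}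
    (hδ : 0 < δ) :
    ∃ u ∈ A, ∃ v ∈ A, u * v = 1 ∧ u w₁ = -u w₂ ∧ ∀ w, |‖u w‖ - 1| ≤ δ := by
  obtain ⟨_, ⟨p, hp, rfl⟩, hpw⟩ := hA.separatesPoints hw
  have hpw' : p w₁ - p w₂ ≠ 0 := sub_ne_zero.2 hpw
  set g : C(Ω, ℂ) := (p w₁ - p w₂)⁻¹ • p with hg
  have hgA : g ∈ A := A.smul_mem hp _
  have hg1 : g w₁ - g w₂ = 1 := by
    simp only [hg, ContinuousMap.smul_apply, smul_eq_mul, ← mul_sub]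
    exact inv_mul_cancel₀ hpw'
  -- `N` bounds the imaginary part of `h - i D g` below, whatever `h` is, so it may be fixed before
  -- `h` is chosen.
  set N : ℝ := 2 * Real.pi + 4 * Real.pi * ‖g‖ with hN
  have hπ := Real.pi_pos
  have hN0 : 0 < N := by positivity
  -- Fits the estimate `|exp x - 1| ≤ 2|x|`, valid for `|x| ≤ 1`.
  set κ : ℝ := min 1 (δ / 2) with hκ
  have hκ0 : 0 < κ := lt_min one_pos (by linarith)
  obtain ⟨h, hh, him, hre⟩ := exists_re_sub_ge_of_notMem_gleasonPart hA.isClosed h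
    (M := Real.pi * N / κ) (by positivity)
  set R : ℝ := (h w₁ - h w₂).re with hR
  set D : ℝ := (h w₁ - h w₂).im with hD
  have hR0 : 0 < R := lt_of_lt_of_le (by positivity) hre
  have hDle : |D| ≤ 4 * Real.pi := by
    rw [hD, Complex.sub_im]
    exact (abs_sub _ _).trans (by linarith [him w₁, him w₂])
  have hRκ : Real.pi / R * N ≤ κ := by
    rw [div_mul_eq_mul_div, div_le_iff₀ hR0, ← div_le_iff₀' hκ0]
    have : 0 ≤ Real.pi * N / κ := by positivity
    linarith
  -- Subtracting `i D g` makes the difference of values real, equal to `R`; the factor π/R makes it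
  -- exactly π and shrinks the imaginary part below κ.
  set k : C(Ω, ℂ) := ((Real.pi / R : ℝ) : ℂ) • (h - ((D : ℂ) * Complex.I) • g) with hk
  have hkA : k ∈ A := A.smul_mem (A.sub_mem hh (A.smul_mem hgA _)) _
  have hkw : ∀ w, k w = ((Real.pi / R : ℝ) : ℂ) * (h w - (D : ℂ) * Complex.I * g w) :=
    fun w => by simp [hk]
  have hkdiff : k w₁ = k w₂ + Real.pi := by
    rw [← sub_eq_iff_eq_add', hkw, hkw, ← mul_sub]
    have e1 : h w₁ - (D : ℂ) * Complex.I * g w₁ - (h w₂ - (D : ℂ) * Complex.I * g w₂) =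
        (h w₁ - h w₂) - (D : ℂ) * Complex.I * (g w₁ - g w₂) := by ring
    have e2 : h w₁ - h w₂ = R + D * Complex.I := (Complex.re_add_im _).symm
    rw [e1, hg1, e2, mul_one, add_sub_cancel_right, ← Complex.ofReal_mul,
      div_mul_cancel₀ _ hR0.ne']
  have hkim : ∀ w, |(k w).im| ≤ κ := fun w => by
    rw [hkw, Complex.im_ofReal_mul, abs_mul,
      abs_of_pos (by positivity : 0 < Real.pi / R), Complex.sub_im]
    refine le_trans (mul_le_mul_of_nonneg_left ?_ (by positivity)) hRκ
    refine (abs_sub _ _).trans (add_le_add (him w) ?_)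
    refine (Complex.abs_im_le_norm _).trans ?_
    rw [norm_mul, norm_mul, Complex.norm_I, mul_one, Complex.norm_real, Real.norm_eq_abs]
    exact mul_le_mul hDle (g.norm_coe_le_norm w) (norm_nonneg _) (by positivity)
  obtain ⟨u, hu, huw⟩ := exists_mem_exp hA.isClosed (A.smul_mem hkA Complex.I)
  obtain ⟨v, hv, hvw⟩ := exists_mem_exp hA.isClosed (A.smul_mem hkA (-Complex.I))
  refine ⟨u, hu, v, hv, ?_, ?_, fun w => ?_⟩
  · ext w
    simp [huw, hvw, ← Complex.exp_add]
  · have huk : ∀ w, u w = Complex.exp (Complex.I * k w) := huw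
    rw [huk, huk, hkdiff, mul_add, Complex.exp_add, mul_comm Complex.I (Real.pi : ℂ),
      Complex.exp_pi_mul_I, mul_neg_one]
  · have h1 : ‖u w‖ = Real.exp (-(k w).im) := by
      rw [huw, Complex.norm_exp]
      simp
    rw [h1]
    have h2 : |-(k w).im| ≤ κ := by rw [abs_neg]; exact hkim w
    refine (Real.abs_exp_sub_one_le (h2.trans (min_le_left _ _))).trans ?_
    linarith [min_le_right 1 (δ / 2)]

variable {w₁ w₂ : Ω} {G : A}

/-- The sign changes of `G` and of a nearly unimodular unit `u` cancel in `G * u`. -/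
theorem modulus_mem_invModuliClosurePos_twoPointSubalgebra (hA : IsUniformAlgebra A)
    (hw : w₁ ≠ w₂) (hG : IsUnit G) (h1 : (G : C(Ω, ℂ)) w₁ = 1) (h2 : (G : C(Ω, ℂ)) w₂ = -1)
    (h : evalCharacter A w₂ ∉ gleasonPart (evalCharacter A w₁)) :
    modulus (G : C(Ω, ℂ)) ∈ invModuliClosurePos (twoPointSubalgebra A w₁ w₂) := by
  obtain ⟨G', hG'⟩ := hG.exists_right_inv
  have hGw := mul_eq_one_apply hG'
  refine ⟨Metric.mem_closure_iff.2 fun ε hε => ?_,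
    fun w => norm_pos_iff.2 (left_ne_zero_of_mul_eq_one (hGw w))⟩
  obtain ⟨u, hu, v, hv, huv, hneg, hnorm⟩ := exists_unit_apply_eq_neg_of_notMem_gleasonPart hA hw h
    (δ := ε / 2 / (‖(G : C(Ω, ℂ))‖ + 1)) (by positivity)
  have huvw : ∀ w, u w * v w = 1 := fun w => by
    simpa using congrArg (fun a : C(Ω, ℂ) => a w) huv
  have hvneg : v w₁ = -v w₂ := by
    rw [eq_inv_of_mul_eq_one_right (huvw w₁), eq_inv_of_mul_eq_one_right (huvw w₂), hneg, inv_neg]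
  have hG1' := hGw w₁
  have hG2' := hGw w₂
  rw [h1, one_mul] at hG1'
  rw [h2, neg_one_mul, neg_eq_iff_eq_neg] at hG2'
  let x : twoPointSubalgebra A w₁ w₂ := ⟨G * u, A.mul_mem G.2 hu, by simp [h1, h2, hneg]⟩
  let y : twoPointSubalgebra A w₁ w₂ := ⟨G' * v, A.mul_mem G'.2 hv, by simp [hG1', hG2', hvneg]⟩
  have hxy : x * y = 1 := by
    refine Subtype.ext (ContinuousMap.ext fun w => ?_)
    change (G : C(Ω, ℂ)) w * u w * ((G' : C(Ω, ℂ)) w * v w) = 1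
    rw [mul_mul_mul_comm, hGw, huvw, one_mul]
  refine ⟨modulus (x : C(Ω, ℂ)), ⟨x, IsUnit.of_mul_eq_one y hxy, rfl⟩, ?_⟩
  refine lt_of_le_of_lt ((ContinuousMap.dist_le (by positivity)).2 fun w => ?_) (half_lt_self hε)
  change dist ‖(G : C(Ω, ℂ)) w‖ ‖(G : C(Ω, ℂ)) w * u w‖ ≤ _
  rw [dist_comm, Real.dist_eq, norm_mul, ← mul_sub_one, abs_mul, abs_norm]
  calc _ ≤ (‖(G : C(Ω, ℂ))‖ + 1) * (ε / 2 / (‖(G : C(Ω, ℂ))‖ + 1)) :=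
        mul_le_mul (((G : C(Ω, ℂ)).norm_coe_le_norm w).trans (by linarith)) (hnorm w)
          (abs_nonneg _) (by positivity)
    _ = ε / 2 := by field_simp

theorem notMem_gleasonPart_of_modulus_mem_tightClass (hG : IsUnit G)
    (h1 : (G : C(Ω, ℂ)) w₁ = 1) (h2 : (G : C(Ω, ℂ)) w₂ = -1)
    (h : modulus (G : C(Ω, ℂ)) ∈ tightClass (twoPointSubalgebra A w₁ w₂)) :
    evalCharacter A w₂ ∉ gleasonPart (evalCharacter A w₁) := by
  obtain ⟨G', hG'⟩ := hG.exists_right_inv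
  have hGw := mul_eq_one_apply hG'
  obtain ⟨-, m, K, H, hKH, hK, hH⟩ := h
  have hG1' := hGw w₁
  have hG2' := hGw w₂
  rw [h1, one_mul] at hG1'
  rw [h2, neg_one_mul, neg_eq_iff_eq_neg] at hG2'
  refine (not_lt (α := ℝ)).2 ?_
  set Φ := WeakDual.toStrongDual (evalCharacter A w₁ : WeakDual ℂ A) -
      WeakDual.toStrongDual (evalCharacter A w₂ : WeakDual ℂ A) with hΦ
  have key : ∀ ε : ℝ, 0 < ε → 2 ≤ ‖Φ‖ * ((1 + ε) * (1 + ε)) := by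
    intro ε hε
    have e1 := Metric.tendstoUniformly_iff.1 hK (ε / (‖(G' : C(Ω, ℂ))‖ + 1)) (by positivity)
    have e2 := Metric.tendstoUniformly_iff.1 hH ε hε
    obtain ⟨n, hn1, hn2⟩ := (e1.and e2).exists
    have hHn : tupleNorm (H n) w₁ ≤ 1 + ε := by
      have := hn2 w₁
      simp only [modulus, ContinuousMap.coe_mk, h1, norm_one, inv_one, Real.dist_eq] at this
      linarith [(abs_lt.1 this).1]
    have hKn : ∀ w, ‖(G' : C(Ω, ℂ)) w‖ * tupleNorm (K n) w ≤ 1 + ε := fun w => by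
      have e3 := hn1 w
      have e4 := congrArg norm (hGw w)
      have e5 := (G' : C(Ω, ℂ)).norm_coe_le_norm w
      rw [norm_mul, norm_one] at e4
      simp only [modulus, ContinuousMap.coe_mk, Real.dist_eq] at e3
      have e6 : tupleNorm (K n) w ≤ ‖(G : C(Ω, ℂ)) w‖ + ε / (‖(G' : C(Ω, ℂ))‖ + 1) := by
        linarith [(abs_lt.1 e3).1]
      calc _ ≤ ‖(G' : C(Ω, ℂ)) w‖ * (‖(G : C(Ω, ℂ)) w‖ + ε / (‖(G' : C(Ω, ℂ))‖ + 1)) := by gcongr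
        _ = 1 + ‖(G' : C(Ω, ℂ)) w‖ * (ε / (‖(G' : C(Ω, ℂ))‖ + 1)) := by
            rw [mul_add, mul_comm, e4]
        _ ≤ 1 + (‖(G' : C(Ω, ℂ))‖ + 1) * (ε / (‖(G' : C(Ω, ℂ))‖ + 1)) := by
            gcongr; linarith
        _ = 1 + ε := by field_simp
    -- Freezing `H` at `w₁` leaves an element of `A`. The sum `∑ Hᵢ(w₁) Kᵢ` is 1 at both points
    -- because `Kᵢ(w₁) = Kᵢ(w₂)`, so only `G'` produces the signs.
    let a : A := ∑ i, ((H n i : C(Ω, ℂ)) w₁) • (⟨K n i, (K n i).2.1⟩ * G')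
    have haw : ∀ w, (a : C(Ω, ℂ)) w =
        (G' : C(Ω, ℂ)) w * ∑ i, (K n i : C(Ω, ℂ)) w * (H n i : C(Ω, ℂ)) w₁ := fun w => by
      simp only [a, AddSubmonoidClass.coe_finsetSum, ContinuousMap.sum_apply, Finset.mul_sum]
      refine Finset.sum_congr rfl fun i _ => ?_
      simp only [SetLike.val_smul, MulMemClass.coe_mul, ContinuousMap.smul_apply,
        ContinuousMap.mul_apply, smul_eq_mul]
      ring
    have hsum := sum_mul_eq_one_apply (hKH n) w₁
    have ha1 : (a : C(Ω, ℂ)) w₁ = 1 := by rw [haw, hsum, hG1', mul_one]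
    have ha2 : (a : C(Ω, ℂ)) w₂ = -1 := by
      rw [haw, Finset.sum_congr rfl fun i _ => by rw [← (K n i).2.2], hsum, hG2', mul_one]
    have hnorm : ‖a‖ ≤ (1 + ε) * (1 + ε) := by
      refine (ContinuousMap.norm_le _ (by positivity)).2 fun w => ?_
      change ‖(a : C(Ω, ℂ)) w‖ ≤ _
      rw [haw, norm_mul]
      calc _ ≤ ‖(G' : C(Ω, ℂ)) w‖ * (tupleNorm (K n) w * tupleNorm (H n) w₁) := by
            gcongr
            exact norm_sum_mul_le_sqrt_mul_sqrt _ _ _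
        _ = ‖(G' : C(Ω, ℂ)) w‖ * tupleNorm (K n) w * tupleNorm (H n) w₁ := by ring
        _ ≤ _ := mul_le_mul (hKn w) hHn (Real.sqrt_nonneg _) (by positivity)
    have hΦa : Φ a = 2 := by
      rw [hΦ, evalCharacter_sub_apply, ha1, ha2]
      norm_num
    calc (2 : ℝ) = ‖Φ a‖ := by rw [hΦa]; simp
      _ ≤ ‖Φ‖ * ‖a‖ := Φ.le_opNorm a
      _ ≤ _ := by gcongr
  have hlim : Tendsto (fun ε : ℝ => ‖Φ‖ * ((1 + ε) * (1 + ε))) (𝓝[>] 0) (𝓝 ‖Φ‖) := by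
    have : Continuous fun ε : ℝ => ‖Φ‖ * ((1 + ε) * (1 + ε)) := by fun_prop
    simpa using (this.tendsto 0).mono_left nhdsWithin_le_nhds
  exact ge_of_tendsto hlim (eventually_nhdsWithin_of_forall fun ε hε => key ε hε)

end UniformAlgebra

/-! ### Möbius maps, the disk algebra and its restriction to the circle. -/

section Disk

/-- The Möbius transformation of the disk which vanishes at `m`. -/
noncomputable def mobius (m z : ℂ) : ℂ := (z - m) / (1 - conj m * z)

theorem mobius_denom_ne_zero {m z : ℂ} (hm : ‖m‖ < 1) (hz : ‖z‖ ≤ 1) : 1 - conj m * z ≠ 0 := by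
  intro h
  have h1 : ‖conj m * z‖ = 1 := by rw [← sub_eq_zero.1 h, norm_one]
  rw [norm_mul, Complex.norm_conj] at h1
  nlinarith [norm_nonneg m, norm_nonneg z]

/-- The sign of the last product decides how `‖mobius m z‖` compares with 1. -/
theorem norm_sub_sq_eq (m z : ℂ) :
    ‖z - m‖ ^ 2 = ‖1 - conj m * z‖ ^ 2 - (1 - ‖m‖ ^ 2) * (1 - ‖z‖ ^ 2) := by
  simp only [← Complex.normSq_eq_norm_sq, Complex.normSq_apply, Complex.sub_re, Complex.sub_im,
    Complex.mul_re, Complex.mul_im, Complex.conj_re, Complex.conj_im, Complex.one_re,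
    Complex.one_im]
  ring

theorem norm_mobius_lt_one {m z : ℂ} (hm : ‖m‖ < 1) (hz : ‖z‖ < 1) : ‖mobius m z‖ < 1 := by
  have h0 : 0 < ‖1 - conj m * z‖ := norm_pos_iff.2 (mobius_denom_ne_zero hm hz.le)
  rw [mobius, norm_div, div_lt_one h0, ← pow_lt_pow_iff_left₀ (norm_nonneg _) h0.le two_ne_zero,
    norm_sub_sq_eq, sub_lt_self_iff]
  exact mul_pos (by nlinarith [norm_nonneg m]) (by nlinarith [norm_nonneg z])

theorem norm_mobius_le_one {m z : ℂ} (hm : ‖m‖ < 1) (hz : ‖z‖ ≤ 1) : ‖mobius m z‖ ≤ 1 := by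
  have h0 : 0 < ‖1 - conj m * z‖ := norm_pos_iff.2 (mobius_denom_ne_zero hm hz)
  rw [mobius, norm_div, div_le_one h0, ← pow_le_pow_iff_left₀ (norm_nonneg _) h0.le two_ne_zero,
    norm_sub_sq_eq, sub_le_self_iff]
  exact mul_nonneg (by nlinarith [norm_nonneg m]) (by nlinarith [norm_nonneg z])

theorem norm_mobius_eq_one {m z : ℂ} (hm : ‖m‖ < 1) (hz : ‖z‖ = 1) : ‖mobius m z‖ = 1 := by
  have h0 : 0 < ‖1 - conj m * z‖ := norm_pos_iff.2 (mobius_denom_ne_zero hm hz.le)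
  rw [mobius, norm_div, div_eq_one_iff_eq h0.ne', ← pow_left_inj₀ (norm_nonneg _) h0.le two_ne_zero,
    norm_sub_sq_eq, hz]
  ring

@[simp]
theorem mobius_self (m : ℂ) : mobius m m = 0 := by simp [mobius]

@[simp]
theorem mobius_zero_right (m : ℂ) : mobius m 0 = -m := by simp [mobius]

theorem mobius_neg_mobius {m z : ℂ} (hm : ‖m‖ < 1) (hz : ‖z‖ ≤ 1) :
    mobius (-m) (mobius m z) = z := by
  have h0 := mobius_denom_ne_zero hm hz
  have h1 := mobius_denom_ne_zero hm hm.le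
  have h2 : 1 - conj (-m) * mobius m z = (1 - conj m * m) / (1 - conj m * z) := by
    rw [mobius, map_neg, eq_div_iff h0]
    field_simp
    ring
  have h3 : mobius m z - -m = z * (1 - conj m * m) / (1 - conj m * z) := by
    rw [mobius, sub_neg_eq_add, div_add' _ _ _ h0]
    congr 1
    ring
  rw [mobius, h2, h3, div_div_div_cancel_right₀ h0, mul_div_cancel_right₀ _ h1]

theorem differentiableOn_mobius_comp {m : ℂ} (hm : ‖m‖ < 1) {F : ℂ → ℂ} {s : Set ℂ}
    (hF : DifferentiableOn ℂ F s) (h1 : ∀ z ∈ s, ‖F z‖ ≤ 1) :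
    DifferentiableOn ℂ (fun z => mobius m (F z)) s :=
  (hF.sub_const m).div ((differentiableOn_const 1).sub (hF.const_mul _))
    fun z hz => mobius_denom_ne_zero hm (h1 z hz)

theorem norm_coe_le_one (z : ClosedDisk) : ‖(z : ℂ)‖ ≤ 1 := mem_closedBall_zero_iff.1 z.2

theorem norm_circle_eq_one (z : UnitCircle) : ‖(z : ℂ)‖ = 1 := mem_sphere_zero_iff_norm.1 z.2

/-- Extension by zero of a function on the closed disk to the plane. -/
noncomputable def extendByZero (f : ClosedDisk → ℂ) (z : ℂ) : ℂ :=
  open Classical in if h : z ∈ Metric.closedBall (0 : ℂ) 1 then f ⟨z, h⟩ else 0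

@[simp]
theorem extendByZero_coe (f : ClosedDisk → ℂ) (z : ClosedDisk) : extendByZero f z = f z :=
  dif_pos z.2

/-- Trades the existential holomorphic function for one canonical extension. -/
theorem mem_diskAlgebra_iff {f : C(ClosedDisk, ℂ)} :
    f ∈ diskAlgebra ↔ DifferentiableOn ℂ (extendByZero f) (Metric.ball 0 1) := by
  refine ⟨?_, fun h => ⟨_, h, fun z _ => extendByZero_coe f z⟩⟩
  rintro ⟨F, hF, hf⟩
  refine hF.congr fun z hz => ?_
  have := extendByZero_coe f ⟨z, Metric.ball_subset_closedBall hz⟩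
  exact this.trans (hf ⟨z, _⟩ hz).symm

theorem diffContOnCl_extendByZero {f : C(ClosedDisk, ℂ)} (hf : f ∈ diskAlgebra) :
    DiffContOnCl ℂ (extendByZero f) (Metric.ball 0 1) := by
  refine ⟨mem_diskAlgebra_iff.1 hf, ?_⟩
  rw [closure_ball _ one_ne_zero, continuousOn_iff_continuous_domRestrict]
  exact f.continuous.congr fun z => (extendByZero_coe f z).symm

/-- The maximum modulus principle for the disk algebra. -/
theorem norm_apply_le_of_forall_circle {f : C(ClosedDisk, ℂ)} (hf : f ∈ diskAlgebra) {C : ℝ}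
    (hC : ∀ z, ‖f (circleInclusion z)‖ ≤ C) (z : ClosedDisk) : ‖f z‖ ≤ C := by
  rw [← extendByZero_coe f z]
  refine Complex.norm_le_of_forall_mem_frontier_norm_le Metric.isBounded_ball
    (diffContOnCl_extendByZero hf) (fun w hw => ?_) ?_
  · rw [frontier_ball _ one_ne_zero] at hw
    have := hC ⟨w, hw⟩
    rwa [← extendByZero_coe f (circleInclusion _)] at this
  · rw [closure_ball _ one_ne_zero]
    exact z.2

theorem eq_of_comp_circleInclusion_eq {f g : C(ClosedDisk, ℂ)} (hf : f ∈ diskAlgebra)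
    (hg : g ∈ diskAlgebra) (h : ∀ z, f (circleInclusion z) = g (circleInclusion z)) : f = g := by
  ext z
  refine sub_eq_zero.1 (norm_le_zero_iff.1 ?_)
  exact norm_apply_le_of_forall_circle (diskAlgebra.sub_mem hf hg)
    (fun z => by simp [h z]) z

/-- The maximum modulus principle for tuples over the disk algebra. -/
theorem sum_norm_sq_apply_le_of_forall_circle {n : ℕ} {f : Fin n → C(ClosedDisk, ℂ)}
    (hf : ∀ i, f i ∈ diskAlgebra) {C : ℝ}
    (hC : ∀ z, ∑ i, ‖f i (circleInclusion z)‖ ^ 2 ≤ C) (z : ClosedDisk) :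
    ∑ i, ‖f i z‖ ^ 2 ≤ C := by
  have hS0 : 0 ≤ ∑ i, ‖f i z‖ ^ 2 := Finset.sum_nonneg fun _ _ => by positivity
  set S := ∑ i, ‖f i z‖ ^ 2 with hS
  -- With coefficients frozen at `z`, this combination has value `S` at `z` and is at most `√S * √C`
  -- on the circle.
  have hmem : ∑ i, conj (f i z) • f i ∈ diskAlgebra :=
    diskAlgebra.sum_mem fun i _ => diskAlgebra.smul_mem (hf i) _
  have happ : ∀ w, (∑ i, conj (f i z) • f i) w = ∑ i, conj (f i z) * f i w := fun w => by
    simp [ContinuousMap.sum_apply]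
  have h1 := norm_apply_le_of_forall_circle hmem (C := √S * √C) (fun w => by
    rw [happ]
    refine (norm_sum_mul_le_sqrt_mul_sqrt _ _ _).trans ?_
    simp only [Complex.norm_conj]
    exact mul_le_mul_of_nonneg_left (Real.sqrt_le_sqrt (hC w)) (Real.sqrt_nonneg _)) z
  have h2 : ∑ i, conj (f i z) * f i z = (S : ℂ) := by
    rw [hS]
    push_cast
    exact Finset.sum_congr rfl fun i _ => Complex.conj_mul' _
  rw [happ, h2, Complex.norm_real, Real.norm_of_nonneg hS0] at h1
  rcases hS0.eq_or_lt with h0 | h0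
  · rw [← h0]
    exact (Finset.sum_nonneg fun _ _ => by positivity).trans (hC ⟨1, by simp⟩)
  · have h3 : √S ≤ √C := by
      have h4 := Real.sqrt_pos.2 h0
      nlinarith [Real.mul_self_sqrt hS0]
    exact (Real.sqrt_le_sqrt_iff' h0).1 h3

theorem isClosed_diskAlgebra : IsClosed (diskAlgebra : Set C(ClosedDisk, ℂ)) := by
  refine IsSeqClosed.isClosed fun u f hu hlim => mem_diskAlgebra_iff.2 ?_
  rw [ContinuousMap.tendsto_iff_tendstoUniformly] at hlim
  have h1 : TendstoUniformlyOn (fun n => extendByZero (u n)) (extendByZero f) atTop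
      (Metric.ball 0 1) := by
    rw [Metric.tendstoUniformly_iff] at hlim
    refine Metric.tendstoUniformlyOn_iff.2 fun ε hε => (hlim ε hε).mono fun n hn z hz => ?_
    have h2 := hn ⟨z, Metric.ball_subset_closedBall hz⟩
    rwa [← extendByZero_coe f ⟨z, _⟩, ← extendByZero_coe (u n) ⟨z, _⟩] at h2
  exact h1.tendstoLocallyUniformlyOn.differentiableOn
    (Eventually.of_forall fun n => mem_diskAlgebra_iff.1 (hu n)) Metric.isOpen_ball

theorem isClosed_twoPointSubalgebra {Ω : Type*} [TopologicalSpace Ω] [CompactSpace Ω]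
    {A : Subalgebra ℂ C(Ω, ℂ)} (hA : IsClosed (A : Set C(Ω, ℂ))) (w₁ w₂ : Ω) :
    IsClosed (twoPointSubalgebra A w₁ w₂ : Set C(Ω, ℂ)) :=
  hA.inter (isClosed_eq (ContinuousMap.evalCLM ℂ w₁).continuous
    (ContinuousMap.evalCLM ℂ w₂).continuous)

/-- By the maximum principle restriction is isometric, so the image of the complete `B` is closed.
-/
theorem isClosed_restrictToCircle {B : Subalgebra ℂ C(ClosedDisk, ℂ)}
    (hB : IsClosed (B : Set C(ClosedDisk, ℂ))) (hle : B ≤ diskAlgebra) :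
    IsClosed (restrictToCircle B : Set C(UnitCircle, ℂ)) := by
  let r : B →ₐ[ℂ] C(UnitCircle, ℂ) :=
    (ContinuousMap.compRightAlgHom ℂ ℂ circleInclusion).comp B.val
  have hr : Isometry r := AddMonoidHomClass.isometry_of_norm r fun f => by
    refine le_antisymm ((ContinuousMap.norm_le _ (norm_nonneg _)).2 fun z =>
      (f : C(ClosedDisk, ℂ)).norm_coe_le_norm (circleInclusion z)) ?_
    exact (ContinuousMap.norm_le _ (norm_nonneg _)).2 (norm_apply_le_of_forall_circle (hle f.2)
      fun z => (r f).norm_coe_le_norm z)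
  have : CompleteSpace B := hB.completeSpace_coe
  have hrange : (restrictToCircle B : Set C(UnitCircle, ℂ)) = Set.range r := by
    ext g
    constructor
    · rintro ⟨f, hf, rfl⟩
      exact ⟨⟨f, hf⟩, rfl⟩
    · rintro ⟨f, rfl⟩
      exact ⟨f, f.2, rfl⟩
  rw [hrange]
  exact hr.isClosedEmbedding.isClosed_range

/-- The coordinate function on the closed disk. -/
def coordinate : C(ClosedDisk, ℂ) := ⟨Subtype.val, continuous_subtype_val⟩

@[simp]
theorem coordinate_apply (z : ClosedDisk) : coordinate z = z := rfl

theorem coordinate_mem_diskAlgebra : coordinate ∈ diskAlgebra :=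
  ⟨id, differentiableOn_id, fun _ _ => rfl⟩

/-- Points of the circle are separated by `p = (z - α)(z - β)` or by `z p`: both vanish at `α` and
`β`, and `p` has no zero on the circle. -/
theorem isUniformAlgebra_restrictToCircle_twoPointSubalgebra (α β : ClosedDisk)
    (hα : ‖(α : ℂ)‖ < 1) (hβ : ‖(β : ℂ)‖ < 1) :
    IsUniformAlgebra (restrictToCircle (twoPointSubalgebra diskAlgebra α β)) := by
  refine ⟨isClosed_restrictToCircle (isClosed_twoPointSubalgebra isClosed_diskAlgebra α β)
    fun f hf => hf.1, fun z w hzw => ?_⟩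
  let p : C(ClosedDisk, ℂ) :=
    (coordinate - algebraMap ℂ _ (α : ℂ)) * (coordinate - algebraMap ℂ _ (β : ℂ))
  have hp : p ∈ diskAlgebra := diskAlgebra.mul_mem
    (diskAlgebra.sub_mem coordinate_mem_diskAlgebra (diskAlgebra.algebraMap_mem _))
    (diskAlgebra.sub_mem coordinate_mem_diskAlgebra (diskAlgebra.algebraMap_mem _))
  have hpz : ∀ z, p z = ((z : ℂ) - α) * (z - β) := fun z => rfl
  have hpA : p ∈ twoPointSubalgebra diskAlgebra α β := ⟨hp, by simp [hpz]⟩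
  have hqA : coordinate * p ∈ twoPointSubalgebra diskAlgebra α β :=
    ⟨diskAlgebra.mul_mem coordinate_mem_diskAlgebra hp, by simp [hpz]⟩
  have hne : ∀ {a : ClosedDisk}, ‖(a : ℂ)‖ < 1 → (w : ℂ) - a ≠ 0 := fun ha h => by
    rw [← sub_eq_zero.1 h, norm_circle_eq_one] at ha
    exact lt_irrefl _ ha
  by_cases h : p (circleInclusion z) = p (circleInclusion w)
  · refine ⟨_, ⟨_, ⟨coordinate * p, hqA, rfl⟩, rfl⟩, fun h2 => hzw (Subtype.ext ?_)⟩
    change (z : ℂ) * p (circleInclusion z) = (w : ℂ) * p (circleInclusion w) at h2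
    rw [h] at h2
    exact mul_right_cancel₀ (mul_ne_zero (hne hα) (hne hβ)) h2
  · exact ⟨_, ⟨_, ⟨p, hpA, rfl⟩, rfl⟩, h⟩

theorem exists_isUnit_diskAlgebra_apply_eq_neg {α β : ClosedDisk} (h : α ≠ β) :
    ∃ G : diskAlgebra, IsUnit G ∧ (G : C(ClosedDisk, ℂ)) α = -(G : C(ClosedDisk, ℂ)) β := by
  have hd : (α : ℂ) - β ≠ 0 := sub_ne_zero.2 fun h1 => h (Subtype.ext h1)
  set c : ℂ := Real.pi * Complex.I / (α - β) with hc
  have key : ∀ c : ℂ, ∃ u ∈ diskAlgebra, ∀ z : ClosedDisk, u z = Complex.exp (c * z) := fun c =>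
    exists_mem_exp isClosed_diskAlgebra (diskAlgebra.smul_mem coordinate_mem_diskAlgebra c)
  obtain ⟨u, hu, huz⟩ := key c
  obtain ⟨v, hv, hvz⟩ := key (-c)
  refine ⟨⟨u, hu⟩, IsUnit.of_mul_eq_one ⟨v, hv⟩ (Subtype.ext (ContinuousMap.ext fun z => ?_)), ?_⟩
  · change u z * v z = 1
    rw [huz, hvz, ← Complex.exp_add]
    simp
  · have h1 : c * α = c * β + Real.pi * Complex.I := by
      rw [← sub_eq_iff_eq_add', ← mul_sub, hc, div_mul_cancel₀ _ hd]
    change u α = -u β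
    rw [huz, huz, h1, Complex.exp_add, Complex.exp_pi_mul_I, mul_neg_one]

theorem exists_mem_diskAlgebra_mobius {f : C(ClosedDisk, ℂ)} (hf : f ∈ diskAlgebra)
    (h1 : ∀ z, ‖f z‖ ≤ 1) {m : ℂ} (hm : ‖m‖ < 1) :
    ∃ g ∈ diskAlgebra, ∀ z, g z = mobius m (f z) := by
  obtain ⟨F, hF, hFf⟩ := hf
  refine ⟨⟨fun z => mobius m (f z), ?_⟩, ⟨fun z => mobius m (F z), ?_, fun z hz => ?_⟩,
    fun z => rfl⟩
  · exact (f.continuous.sub continuous_const).div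
      (continuous_const.sub (continuous_const.mul f.continuous))
      fun z => mobius_denom_ne_zero hm (h1 z)
  · refine differentiableOn_mobius_comp hm hF fun z hz => ?_
    rw [hFf ⟨z, Metric.ball_subset_closedBall hz⟩ hz]
    exact h1 _
  · exact congrArg (mobius m) (hFf z hz)

/-- The hyperbolic midpoint of `0` and `c`. -/
theorem exists_mobius_eq_self {c : ℂ} (hc : ‖c‖ < 1) : ∃ m : ℂ, ‖m‖ < 1 ∧ mobius m c = m := by
  have hr : 0 ≤ 1 - ‖c‖ ^ 2 := by nlinarith [norm_nonneg c]
  set s := √(1 - ‖c‖ ^ 2) with hs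
  have hs0 : 0 ≤ s := Real.sqrt_nonneg _
  have hs2 : s ^ 2 = 1 - ‖c‖ ^ 2 := Real.sq_sqrt hr
  have hm : ‖((1 + s : ℝ) : ℂ)⁻¹ * c‖ < 1 := by
    rw [norm_mul, norm_inv, Complex.norm_real, Real.norm_of_nonneg (by linarith),
      inv_mul_lt_one₀ (by linarith)]
    linarith
  -- For `m = t c` with `t` real the equation becomes `t²|c|² - 2t + 1 = 0` when `c ≠ 0`; its
  -- smaller root is `1 / (1 + s)`.
  refine ⟨((1 + s : ℝ) : ℂ)⁻¹ * c, hm, ?_⟩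
  have h0 := mobius_denom_ne_zero hm hc.le
  have h1 : ((1 + s : ℝ) : ℂ) ≠ 0 := by exact_mod_cast (by linarith : (1 + s : ℝ) ≠ 0)
  have h2 : conj c * c = 1 - (s : ℂ) ^ 2 := by
    rw [Complex.conj_mul']
    exact_mod_cast (by linarith : ‖c‖ ^ 2 = 1 - s ^ 2)
  rw [mobius, div_eq_iff h0]
  have h3 : conj (((1 + s : ℝ) : ℂ)⁻¹ * c) * c = ((1 + s : ℝ) : ℂ)⁻¹ * (1 - (s : ℂ) ^ 2) := by
    rw [map_mul, map_inv₀, Complex.conj_ofReal, mul_assoc, h2]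
  rw [h3]
  field_simp
  push_cast
  ring

/-- A finite Blaschke product taking opposite values at two given points. -/
theorem exists_inner_apply_eq_neg {α β : ClosedDisk} (hα : ‖(α : ℂ)‖ < 1) (hβ : ‖(β : ℂ)‖ < 1) :
    ∃ b ∈ diskAlgebra, (∀ z, ‖b (circleInclusion z)‖ = 1) ∧ b α = -b β := by
  obtain ⟨g, hg, hgz⟩ := exists_mem_diskAlgebra_mobius coordinate_mem_diskAlgebra norm_coe_le_one hα
  have hg1 : ∀ z, ‖g z‖ ≤ 1 := fun z => by
    rw [hgz]
    exact norm_mobius_le_one hα (norm_coe_le_one z)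
  have hgβ : ‖g β‖ < 1 := by
    rw [hgz]
    exact norm_mobius_lt_one hα hβ
  obtain ⟨m, hm, hmc⟩ := exists_mobius_eq_self hgβ
  -- Centred at the midpoint `m` of `g α = 0` and `g β`, this map sends them to `-m` and `m`.
  obtain ⟨b, hb, hbz⟩ := exists_mem_diskAlgebra_mobius hg hg1 hm
  refine ⟨b, hb, fun z => ?_, ?_⟩
  · rw [hbz, hgz]
    exact norm_mobius_eq_one hm (norm_mobius_eq_one hα (norm_circle_eq_one z))
  · rw [hbz, hbz, hmc, hgz]
    simp

/-- A quantitative form of the fact that the open disk is a single Gleason part. -/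
theorem two_mul_le_of_apply_eq_one_of_apply_eq_neg_one {α β : ClosedDisk} (hα : ‖(α : ℂ)‖ < 1)
    (hβ : ‖(β : ℂ)‖ < 1) {f : C(ClosedDisk, ℂ)} (hf : f ∈ diskAlgebra) {C : ℝ} (hC : 1 < C)
    (hfC : ∀ z, ‖f z‖ ≤ C) (h1 : f α = 1) (h2 : f β = -1) :
    2 * C ≤ ‖mobius α β‖ * (C ^ 2 + 1) := by
  have hC0 : 0 < C := by linarith
  have hCc : (C : ℂ) ≠ 0 := by exact_mod_cast hC0.ne'
  have hp : ‖(C : ℂ)⁻¹‖ < 1 := by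
    rw [norm_inv, Complex.norm_real, Real.norm_of_nonneg hC0.le]
    exact inv_lt_one_of_one_lt₀ hC
  have hnegα : ‖-(α : ℂ)‖ < 1 := by rwa [norm_neg]
  have hmaps : Set.MapsTo (mobius (-α)) (Metric.ball 0 1) (Metric.ball 0 1) := fun z hz => by
    rw [mem_ball_zero_iff] at hz ⊢
    exact norm_mobius_lt_one hnegα hz
  set F : ℂ → ℂ := fun z => (C : ℂ)⁻¹ * extendByZero f (mobius (-α) z) with hF
  have hFle : ∀ z ∈ Metric.ball (0 : ℂ) 1, ‖F z‖ ≤ 1 := fun z hz => by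
    have h3 := hfC ⟨_, Metric.ball_subset_closedBall (hmaps hz)⟩
    rw [← extendByZero_coe f ⟨_, _⟩] at h3
    rw [hF, norm_mul, norm_inv, Complex.norm_real, Real.norm_of_nonneg hC0.le,
      inv_mul_le_one₀ hC0]
    exact h3
  have hFd : DifferentiableOn ℂ F (Metric.ball 0 1) := by
    refine DifferentiableOn.const_mul ?_ _
    exact (mem_diskAlgebra_iff.1 hf).comp (differentiableOn_mobius_comp hnegα differentiableOn_id
      fun z hz => (mem_ball_zero_iff.1 hz).le) hmaps
  have hF0 : F 0 = (C : ℂ)⁻¹ := by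
    rw [hF]
    simp [h1]
  have hFβ : F (mobius α β) = -(C : ℂ)⁻¹ := by
    rw [hF]
    simp [mobius_neg_mobius hα hβ.le, h2]
  -- Schwarz lemma for `F` followed by the Möbius map sending `F 0 = C⁻¹` to 0; `1 < C` keeps that
  -- centre inside the disk.
  have key := Complex.norm_le_norm_of_mapsTo_ball (z := mobius α β)
    (differentiableOn_mobius_comp hp hFd hFle)
    (fun z hz => mem_closedBall_zero_iff.2 (norm_mobius_le_one hp (hFle z hz)))
    (by rw [hF0, mobius_self]) (norm_mobius_lt_one hα hβ)
  have hval : mobius (C : ℂ)⁻¹ (-(C : ℂ)⁻¹) = ((-(2 * C / (C ^ 2 + 1)) : ℝ) : ℂ) := by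
    have h3 : (C : ℂ) ^ 2 + 1 ≠ 0 := by exact_mod_cast (by positivity : C ^ 2 + 1 ≠ 0)
    rw [mobius, map_inv₀, Complex.conj_ofReal]
    push_cast
    have h4 : 1 - (C : ℂ)⁻¹ * -(C : ℂ)⁻¹ = (C ^ 2 + 1) / C ^ 2 := by
      field_simp
      ring
    rw [h4]
    field_simp
    ring
  rw [hFβ, hval, Complex.norm_real, norm_neg, Real.norm_of_nonneg (by positivity),
    div_le_iff₀ (by positivity)] at key
  exact key

/-! ### Subequivalence and Morita bimodules over the circle algebra. -/

theorem IsUnitarySubequivalenceBimodule.isStrongSubequivalenceBimodule {Ω : Type*}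
    [TopologicalSpace Ω] {A : Subalgebra ℂ C(Ω, ℂ)} {f : C(Ω, ℝ)}
    (h : IsUnitarySubequivalenceBimodule A f) : IsStrongSubequivalenceBimodule A f := by
  obtain ⟨x, hx, y, hy, hxy⟩ := h
  refine fun ε hε => ⟨1, fun _ => x, fun _ => y, fun _ => hx, fun _ => hy, fun w => ?_⟩
  simp only [(hxy w).1, (hxy w).2, Fin.sum_univ_one]
  refine ⟨⟨?_, ?_⟩, ?_, ?_⟩ <;> linarith

variable {α β : ClosedDisk} {G : diskAlgebra}

theorem isUnitarySubequivalenceBimodule_restrictToCircle (hα : ‖(α : ℂ)‖ < 1)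
    (hβ : ‖(β : ℂ)‖ < 1) (hG : IsUnit G)
    (hαβ : (G : C(ClosedDisk, ℂ)) α = -(G : C(ClosedDisk, ℂ)) β) :
    IsUnitarySubequivalenceBimodule (restrictToCircle (twoPointSubalgebra diskAlgebra α β))
      (modulus ((G : C(ClosedDisk, ℂ)).comp circleInclusion)) := by
  obtain ⟨G', hG'⟩ := hG.exists_right_inv
  have hGz := mul_eq_one_apply hG'
  have hG'αβ : (G' : C(ClosedDisk, ℂ)) α = -(G' : C(ClosedDisk, ℂ)) β := by
    rw [eq_inv_of_mul_eq_one_right (hGz α), eq_inv_of_mul_eq_one_right (hGz β), hαβ, inv_neg]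
  obtain ⟨b, hb, hb1, hbαβ⟩ := exists_inner_apply_eq_neg hα hβ
  have hne : ∀ z, (G : C(ClosedDisk, ℂ)) z ≠ 0 := fun z => left_ne_zero_of_mul_eq_one (hGz z)
  let f : C(UnitCircle, ℝ) := modulus ((G : C(ClosedDisk, ℂ)).comp circleInclusion)
  have hfz : ∀ z, f z = ‖(G : C(ClosedDisk, ℂ)) (circleInclusion z)‖ := fun z => rfl
  have hf0 : ∀ z, f z ≠ 0 := fun z => norm_ne_zero_iff.2 (hne _)
  let x : C(UnitCircle, ℂ) := ⟨fun z => (b * G') (circleInclusion z) * (f z : ℂ), by fun_prop⟩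
  let y : C(UnitCircle, ℂ) := ⟨fun z => (b * G) (circleInclusion z) * ((f z)⁻¹ : ℝ),
    (((b * G : C(ClosedDisk, ℂ)).comp circleInclusion).continuous).mul
      (Complex.continuous_ofReal.comp (f.continuous.inv₀ hf0))⟩
  refine ⟨x, ⟨_, ⟨b * G', ⟨diskAlgebra.mul_mem hb G'.2, ?_⟩, rfl⟩, fun z => rfl⟩,
    y, ⟨_, ⟨b * G, ⟨diskAlgebra.mul_mem hb G.2, ?_⟩, rfl⟩, fun z => rfl⟩, fun z => ⟨?_, ?_⟩⟩
  · simp [hbαβ, hG'αβ]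
  · simp [hbαβ, hαβ]
  · have h1 := congrArg norm (hGz (circleInclusion z))
    rw [norm_mul, norm_one, mul_comm] at h1
    change ‖b (circleInclusion z) * (G' : C(ClosedDisk, ℂ)) (circleInclusion z) * (f z : ℂ)‖ = 1
    rw [norm_mul, norm_mul, hb1, one_mul, Complex.norm_real, hfz, norm_norm, h1]
  · change ‖b (circleInclusion z) * (G : C(ClosedDisk, ℂ)) (circleInclusion z) *
      (((f z)⁻¹ : ℝ) : ℂ)‖ = 1
    rw [norm_mul, norm_mul, hb1, one_mul, Complex.norm_real, norm_inv, hfz, norm_norm]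
    exact mul_inv_cancel₀ (norm_ne_zero_iff.2 (hne _))

theorem not_isStrongMoritaBimodule_restrictToCircle (hα : ‖(α : ℂ)‖ < 1)
    (hβ : ‖(β : ℂ)‖ < 1) (hG : IsUnit G)
    (hαβ : (G : C(ClosedDisk, ℂ)) α = -(G : C(ClosedDisk, ℂ)) β) :
    ¬ IsStrongMoritaBimodule (restrictToCircle (twoPointSubalgebra diskAlgebra α β))
      (modulus ((G : C(ClosedDisk, ℂ)).comp circleInclusion)) := by
  intro hM
  obtain ⟨G', hG'⟩ := hG.exists_right_inv
  have hGz := mul_eq_one_apply hG'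
  have hGne : ∀ z, (G : C(ClosedDisk, ℂ)) z ≠ 0 := fun z => left_ne_zero_of_mul_eq_one (hGz z)
  have key : ∀ ε : ℝ, 0 < ε → 2 * (1 + ε) ≤ ‖mobius α β‖ * ((1 + ε) ^ 2 + 1) := by
    intro ε hε
    obtain ⟨n, x, y, hx, hy, hxy, hle⟩ := hM ε hε
    choose a' ha' hxa using hx
    choose b' hb' hyb using hy
    choose a ha haa' using ha'
    choose b hb hbb' using hb'
    have hax : ∀ i z, x i z = a i (circleInclusion z) *
        (‖(G : C(ClosedDisk, ℂ)) (circleInclusion z)‖ : ℂ) := fun i z => by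
      rw [hxa, ← haa']
      rfl
    have hby : ∀ i z, y i z = b i (circleInclusion z) *
        ((‖(G : C(ClosedDisk, ℂ)) (circleInclusion z)‖⁻¹ : ℝ) : ℂ) := fun i z => by
      rw [hyb, ← hbb']
      rfl
    -- The factors `|G|` and `|G|⁻¹` cancel on the circle, and the maximum principle extends the
    -- identity to `α`.
    have hab : ∑ i, a i * b i = 1 := by
      refine eq_of_comp_circleInclusion_eq
        (diskAlgebra.sum_mem fun i _ => diskAlgebra.mul_mem (ha i).1 (hb i).1)
        diskAlgebra.one_mem fun z => ?_
      have h1 := congrArg (fun g : C(UnitCircle, ℂ) => g z) hxy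
      simp only [ContinuousMap.sum_apply, ContinuousMap.mul_apply, hax, hby] at h1 ⊢
      refine Eq.trans (Finset.sum_congr rfl fun i _ => ?_) h1
      have h2 : (‖(G : C(ClosedDisk, ℂ)) (circleInclusion z)‖ : ℂ) ≠ 0 := by
        exact_mod_cast norm_ne_zero_iff.2 (hGne _)
      push_cast
      field_simp
    have habα : ∑ i, a i α * b i α = 1 := by
      simpa [ContinuousMap.sum_apply] using congrArg (fun g : C(ClosedDisk, ℂ) => g α) hab
    have haG : ∀ z, ∑ i, ‖(a i * G : C(ClosedDisk, ℂ)) z‖ ^ 2 ≤ 1 + ε :=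
      sum_norm_sq_apply_le_of_forall_circle (fun i => diskAlgebra.mul_mem (ha i).1 G.2)
        fun z => by
          refine le_trans (le_of_eq (Finset.sum_congr rfl fun i _ => ?_)) (hle z).1
          rw [hax, ContinuousMap.mul_apply, norm_mul, norm_mul, Complex.norm_real, norm_norm]
    have hbG : ∀ z, ∑ i, ‖(b i * G' : C(ClosedDisk, ℂ)) z‖ ^ 2 ≤ 1 + ε :=
      sum_norm_sq_apply_le_of_forall_circle (fun i => diskAlgebra.mul_mem (hb i).1 G'.2)
        fun z => by
          refine le_trans (le_of_eq (Finset.sum_congr rfl fun i _ => ?_)) (hle z).2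
          rw [hby, ContinuousMap.mul_apply, norm_mul, norm_mul, Complex.norm_real, norm_inv,
            norm_norm, eq_inv_of_mul_eq_one_right (hGz _), norm_inv]
    -- Replacing `|G|` by `G` keeps norms on the circle and makes the tuples holomorphic; since `a i
    -- α = a i β`, the sign of `F β` comes from `G`.
    set F : C(ClosedDisk, ℂ) := ∑ i, ((b i * G' : C(ClosedDisk, ℂ)) α) • (a i * G) with hF
    have hFmem : F ∈ diskAlgebra := diskAlgebra.sum_mem fun i _ =>
      diskAlgebra.smul_mem (diskAlgebra.mul_mem (ha i).1 G.2) _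
    have hFz : ∀ z, F z = ∑ i, (b i * G' : C(ClosedDisk, ℂ)) α * (a i * G : C(ClosedDisk, ℂ)) z :=
      fun z => by simp [hF, ContinuousMap.sum_apply]
    have hFle : ∀ z, ‖F z‖ ≤ 1 + ε := fun z => by
      rw [hFz]
      refine (norm_sum_mul_le_sqrt_mul_sqrt _ _ _).trans ?_
      calc _ ≤ √(1 + ε) * √(1 + ε) :=
            mul_le_mul (Real.sqrt_le_sqrt (hbG α)) (Real.sqrt_le_sqrt (haG z))
              (Real.sqrt_nonneg _) (Real.sqrt_nonneg _)
        _ = 1 + ε := Real.mul_self_sqrt (by linarith)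
    have hFα : F α = 1 := by
      rw [hFz, ← habα]
      refine Finset.sum_congr rfl fun i _ => ?_
      simp only [ContinuousMap.mul_apply]
      linear_combination (a i α * b i α) * hGz α
    have hFβ : F β = -1 := by
      rw [hFz, ← habα, ← Finset.sum_neg_distrib]
      refine Finset.sum_congr rfl fun i _ => ?_
      have h1 : a i α = a i β := (ha i).2
      simp only [ContinuousMap.mul_apply]
      rw [← h1]
      have h2 := hGz α
      rw [hαβ] at h2
      linear_combination (-(a i α * b i α)) * h2
    exact two_mul_le_of_apply_eq_one_of_apply_eq_neg_one hα hβ hFmem (by linarith) hFle hFα hFβ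
  have hlim : Tendsto (fun ε : ℝ => ‖mobius α β‖ * ((1 + ε) ^ 2 + 1) - 2 * (1 + ε)) (𝓝[>] 0)
      (𝓝 (‖mobius α β‖ * ((1 + 0) ^ 2 + 1) - 2 * (1 + 0))) := by
    have : Continuous fun ε : ℝ => ‖mobius α β‖ * ((1 + ε) ^ 2 + 1) - 2 * (1 + ε) := by fun_prop
    exact (this.tendsto 0).mono_left nhdsWithin_le_nhds
  -- In the limit `2 ≤ 2 * ‖mobius α β‖`, which is impossible inside the open disk.
  have h0 := ge_of_tendsto hlim (eventually_nhdsWithin_of_forall fun ε hε =>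
    sub_nonneg.2 (key ε hε))
  have h1 := norm_mobius_lt_one hα hβ
  linarith

end Disk

end FunctionAlgebra

theorem mainTheorem9 :
    (∀ (Ω : Type*) [TopologicalSpace Ω] [CompactSpace Ω] [T2Space Ω]
        (A : Subalgebra ℂ C(Ω, ℂ)), IsUniformAlgebra A →
      ∀ (w₁ w₂ : Ω), w₁ ≠ w₂ →
      ∀ G : A, IsUnit G → (G : C(Ω, ℂ)) w₁ = 1 → (G : C(Ω, ℂ)) w₂ = -1 →
        (modulus (G : C(Ω, ℂ)) ∈
            tightClass (twoPointSubalgebra A w₁ w₂) ↔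
          evalCharacter A w₂ ∉
            gleasonPart (evalCharacter A w₁)) ∧
        (evalCharacter A w₂ ∉
            gleasonPart (evalCharacter A w₁) ↔
          modulus (G : C(Ω, ℂ)) ∈
            invModuliClosurePos
              (twoPointSubalgebra A w₁ w₂))) ∧
    (∀ α β : ClosedDisk, ‖(α : ℂ)‖ < 1 → ‖(β : ℂ)‖ < 1 → α ≠ β →
      IsUniformAlgebra
        (restrictToCircle
          (twoPointSubalgebra diskAlgebra α β)) ∧
      (∃ G : diskAlgebra, IsUnit G ∧
        (G : C(ClosedDisk, ℂ)) α =
          -(G : C(ClosedDisk, ℂ)) β) ∧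
      ∀ G : diskAlgebra, IsUnit G →
        (G : C(ClosedDisk, ℂ)) α =
          -(G : C(ClosedDisk, ℂ)) β →
        IsUnitarySubequivalenceBimodule
          (restrictToCircle
            (twoPointSubalgebra diskAlgebra α β))
          (modulus
            ((G : C(ClosedDisk, ℂ)).comp circleInclusion)) ∧
        IsStrongSubequivalenceBimodule
          (restrictToCircle
            (twoPointSubalgebra diskAlgebra α β))
          (modulus
            ((G : C(ClosedDisk, ℂ)).comp circleInclusion)) ∧
        ¬ IsStrongMoritaBimodule
          (restrictToCircle
            (twoPointSubalgebra diskAlgebra α β))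
          (modulus
            ((G : C(ClosedDisk, ℂ)).comp circleInclusion))) := by
  refine ⟨fun Ω _ _ _ A hA w₁ w₂ hw G hG h1 h2 => ?_, fun α β hα hβ hne => ?_⟩
  · have hT := notMem_gleasonPart_of_modulus_mem_tightClass hG h1 h2
    have hQ := modulus_mem_invModuliClosurePos_twoPointSubalgebra hA hw hG h1 h2
    have hQT := invModuliClosurePos_subset_tightClass (twoPointSubalgebra A w₁ w₂)
    exact ⟨⟨hT, fun h => hQT (hQ h)⟩, hQ, fun h => hT (hQT h)⟩
  · refine ⟨isUniformAlgebra_restrictToCircle_twoPointSubalgebra α β hα hβ,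
      exists_isUnit_diskAlgebra_apply_eq_neg hne, fun G hG hαβ => ?_⟩
    have hU := isUnitarySubequivalenceBimodule_restrictToCircle hα hβ hG hαβ
    exact ⟨hU, hU.isStrongSubequivalenceBimodule,
      not_isStrongMoritaBimodule_restrictToCircle hα hβ hG hαβ⟩
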